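/- Let $G=(V,E)$ be a directed graph with finite edge set $E$ (parallel edges allowed) and two specified vertices $s,t\in V$, and let $k\ge 1$ be an integer. Let $\mathcal F$ be the collection of all sets of edges that contain $k$ edge-disjoint $s$-$t$ paths, and assume that this $k$-paths system $(E,\mathcal F)$ is monopoly-free, i.e. $\bigcap_{T\in\mathcal F}T=\emptyset$. A $k$-path auction on $G$ is a mechanism that maps every bid vector $\mathbf b\in[0,\infty)^E$ to a set of winners in $\mathcal F$ and to payments $p(e)\ge 0$, $e\in E$, with $p(e)\ge b(e)$ for every winner $e$ and $p(e)=0$ for every loser $e$. An agent $e$ with cost $c(e)$ has utility $p(e)-c(e)$ if he wins and $0$ otherwise; agents bid at least their costs. The auction is truthful if, whatever the other agents bid, each agent maximizes his utility by bidding his cost; it is measurable if each payment is a Lebesgue measurable function of the bid vector. For a cost vector $\mathbf c\in[0,\infty)^E$ let $S=S(\mathbf c)\in\mathcal F$ be a feasible set of minimum total cost (ties are broken arbitrarily). Let $\nu(\mathbf c)$ and $\mu(\mathbf c)$ be the minimum and the maximum, respectively, of $\sum_{e\in S}b(e)$ subject to (1) $b(e)\ge c(e)$ for all $e\in E$; (2)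 $\sum_{e\in S\setminus T}b(e)\le\sum_{e\in T\setminus S}c(e)$ for all $T\in\mathcal F$; (3) for every $e\in S$ there is $T\in\mathcal F$ with $e\notin T$ and $\sum_{e'\in S\setminus T}b(e')=\sum_{e'\in T\setminus S}c(e')$. If $p(\mathbf c)$ denotes the total payment of the auction on $\mathbf c$, its frugality ratio is $\sup_{\mathbf c}p(\mathbf c)/\nu(\mathbf c)$ and its $\mu$-frugality ratio is $\sup_{\mathbf c}p(\mathbf c)/\mu(\mathbf c)$, both in $[0,\infty]$ (with $a/0=\infty$ for $a>0$ and $0/0=0$). For a set $G^*$ of edges that is a union of $k+1$ edge-disjoint $s$-$t$ paths, the dependency graph $\mathcal H(G^*)$ has vertex set $G^*$, two distinct edges $e,e'\in G^*$ being adjacent if and only if every $T\in\mathcal F$ with $T\subseteq G^*$ contains $e$ or $e'$. Let $\alpha(G^*)$ be the maximum of the largest eigenvalues of the adjacency matrices of the connected components of $\mathcal H(G^*)$, and let $\alpha_{k+1}$ be the maximum of $\alpha(G^*)$ over all such $G^*$. Theorem. The frugality ratio and the $\mu$-frugality ratio of every measurable truthful $k$-path auction on $G$ are both at least $\alpha_{k+1}/k$.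 -/

import Mathlib

open MeasureTheory
open scoped NNReal ENNReal

noncomputable section

/-! ### Set systems, mechanisms and frugality

A set system on a finite set `E` of agents is the collection `F : Set (Finset E)` of its feasible
sets. Costs and bids are nonnegative reals. -/

namespace Frugality

/-- No agent belongs to all feasible sets. -/
def MonopolyFree {E : Type*} (F : Set (Finset E)) : Prop :=
  ⋂ S ∈ F, (S : Set E) = ∅

/-- A mechanism for `(E, F)`: it maps a bid vector to a feasible set of winners and to payments,
with voluntary participation. (Payments are automatically nonnegative: a winner is paid at least
his bid and a loser is paid zero.) -/
structure Mechanism {E : Type*} (F : Set (Finset E)) where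
  winners : (E → ℝ≥0) → Finset E
  payment : (E → ℝ≥0) → E → ℝ≥0
  winners_mem : ∀ b, winners b ∈ F
  bid_le_payment : ∀ b, ∀ e ∈ winners b, b e ≤ payment b e
  payment_eq_zero : ∀ b, ∀ e ∉ winners b, payment b e = 0

section Mechanism

variable {E : Type*} [DecidableEq E] {F : Set (Finset E)}

/-- The utility of an agent `e` with true cost `x` when the bid vector is `b`. -/
def Mechanism.utility (M : Mechanism F) (e : E) (x : ℝ≥0) (b : E → ℝ≥0) : ℝ :=
  if e ∈ M.winners b then (M.payment b e : ℝ) - x else 0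

/-- Truthfulness: whatever the other agents bid, an agent `e` whose true cost is `b e` maximizes
his utility by bidding `b e`. Agents bid at least their costs, so the competing bids `y` are those
with `b e ≤ y`; a mechanism that is truthful against all bids `y` is truthful in this sense. -/
def Mechanism.Truthful (M : Mechanism F) : Prop :=
  ∀ (e : E) (b : E → ℝ≥0) (y : ℝ≥0), b e ≤ y →
    M.utility e (b e) (Function.update b e y) ≤ M.utility e (b e) b

/-- The payment to each agent is a Lebesgue measurable function of the bid vector, that is,
measurable with respect to the completion of Lebesgue measure on the nonnegative orthant of
`ℝ^E`. -/
def Mechanism.LebesgueMeasurable [Fintype E] (M : Mechanism F) : Prop :=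
  ∀ e : E, NullMeasurable (fun b : E → ℝ => M.payment (fun i => (b i).toNNReal) e)
    (volume.restrict {b : E → ℝ | ∀ i, 0 ≤ b i})

/-- The total payment on the bid vector `b`. -/
def Mechanism.totalPayment [Fintype E] (M : Mechanism F) (b : E → ℝ≥0) : ℝ≥0 :=
  ∑ e, M.payment b e

end Mechanism

/-- `S` is a feasible set of minimum total cost with respect to `c`. -/
def IsCheapest {E : Type*} (F : Set (Finset E)) (c : E → ℝ≥0) (S : Finset E) : Prop :=
  S ∈ F ∧ ∀ T ∈ F, ∑ e ∈ S, c e ≤ ∑ e ∈ T, c e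

/-- The constraints (1), (2), (3) of the programs that define the benchmarks `ν` and `μ`, for the
cost vector `c` and the cheapest feasible set `S`. -/
structure IsEquilibriumBid {E : Type*} [DecidableEq E] (F : Set (Finset E)) (c : E → ℝ≥0)
    (S : Finset E) (b : E → ℝ≥0) : Prop where
  cost_le : ∀ e, c e ≤ b e
  no_improvement : ∀ T ∈ F, ∑ e ∈ S \ T, b e ≤ ∑ e ∈ T \ S, c e
  tight : ∀ e ∈ S, ∃ T ∈ F, e ∉ T ∧ ∑ e' ∈ S \ T, b e' = ∑ e' ∈ T \ S, c e'

/-- The benchmark `ν(c)`: the least total bid of `S` under the constraints. -/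
def nu {E : Type*} [DecidableEq E] (F : Set (Finset E)) (c : E → ℝ≥0) (S : Finset E) : ℝ≥0∞ :=
  ⨅ (b : E → ℝ≥0) (_ : IsEquilibriumBid F c S b), ((∑ e ∈ S, b e : ℝ≥0) : ℝ≥0∞)

/-- The benchmark `μ(c)`: the largest total bid of `S` under the constraints. -/
def mu {E : Type*} [DecidableEq E] (F : Set (Finset E)) (c : E → ℝ≥0) (S : Finset E) : ℝ≥0∞ :=
  ⨆ (b : E → ℝ≥0) (_ : IsEquilibriumBid F c S b), ((∑ e ∈ S, b e : ℝ≥0) : ℝ≥0∞)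

/-- The supremum over all cost vectors of (total payment) / `ν(c)`, where `S c` is the cheapest
feasible set used for the benchmark. In `ℝ≥0∞` one has `a / 0 = ∞` for `a ≠ 0` and `0 / 0 = 0`. -/
def Mechanism.frugalityRatio {E : Type*} [DecidableEq E] [Fintype E] {F : Set (Finset E)}
    (M : Mechanism F) (S : (E → ℝ≥0) → Finset E) : ℝ≥0∞ :=
  ⨆ c : E → ℝ≥0, (M.totalPayment c : ℝ≥0∞) / nu F c (S c)

/-- The supremum over all cost vectors of (total payment) / `μ(c)`. -/
def Mechanism.muFrugalityRatio {E : Type*} [DecidableEq E] [Fintype E] {F : Set (Finset E)}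
    (M : Mechanism F) (S : (E → ℝ≥0) → Finset E) : ℝ≥0∞ :=
  ⨆ c : E → ℝ≥0, (M.totalPayment c : ℝ≥0∞) / mu F c (S c)

/-! ### The dependency graph and its eigenvalue -/

/-- The dependency graph of the agents in `S`: distinct `e, e'` are adjacent iff every feasible
set contained in `S` contains `e` or `e'`. -/
def dependencyGraph {E : Type*} (F : Set (Finset E)) (S : Finset E) : SimpleGraph S where
  Adj e e' := e ≠ e' ∧ ∀ T ∈ F, T ⊆ S → (e : E) ∈ T ∨ (e' : E) ∈ T
  symm := ⟨fun _ _ h => ⟨h.1.symm, fun T hT hTS => (h.2 T hT hTS).symm⟩⟩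
  loopless := ⟨fun _ h => h.1 rfl⟩

/-- The largest real eigenvalue of a square matrix. -/
def largestEigenvalue {ι : Type*} [Fintype ι] [DecidableEq ι] (A : Matrix ι ι ℝ) : ℝ :=
  sSup {r : ℝ | Module.End.HasEigenvalue (Matrix.toLin' A) r}

open Classical in
/-- The maximum, over the connected components of the dependency graph of `S`, of the largest
eigenvalue of the adjacency matrix of the component. -/
def alpha {E : Type*} (F : Set (Finset E)) (S : Finset E) : ℝ :=
  ⨆ C : (dependencyGraph F S).ConnectedComponent,
    largestEigenvalue (((dependencyGraph F S).induce C.supp).adjMatrix ℝ)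

/-! ### `k`-paths systems -/

/-- A directed graph with vertices `V` and edges `E` (parallel edges and loops are allowed). -/
structure DirectedGraph (V E : Type*) where
  src : E → V
  tgt : E → V

namespace DirectedGraph

variable {V E : Type*} (G : DirectedGraph V E)

/-- The edges in the list, traversed in order, lead from `u` to `v`. -/
def IsWalk : V → List E → V → Prop
  | u, [], v => u = v
  | u, e :: l, v => G.src e = u ∧ IsWalk (G.tgt e) l v

/-- The list of edges is a path from `u` to `v`: a walk that visits no vertex twice. -/
def IsPath (u : V) (l : List E) (v : V) : Prop :=
  G.IsWalk u l v ∧ (u :: l.map G.tgt).Nodup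

/-- `P` consists of `m` pairwise edge-disjoint paths from `s` to `t`. -/
def AreDisjointPaths (s t : V) {m : ℕ} (P : Fin m → List E) : Prop :=
  (∀ i, G.IsPath s (P i) t) ∧ ∀ i j, i ≠ j → (P i).Disjoint (P j)

/-- The feasible sets of the `k`-paths system: the sets of edges that contain `k` edge-disjoint
`s`-`t` paths. -/
def kPathSystem (s t : V) (k : ℕ) : Set (Finset E) :=
  {T | ∃ P : Fin k → List E, G.AreDisjointPaths s t P ∧ ∀ i, ∀ e ∈ P i, e ∈ T}

/-- The (edge sets of) subgraphs that are a union of `m` edge-disjoint `s`-`t` paths. -/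
def pathUnions (s t : V) (m : ℕ) : Set (Finset E) :=
  {T | ∃ P : Fin m → List E, G.AreDisjointPaths s t P ∧ ∀ e, e ∈ T ↔ ∃ i, e ∈ P i}

/-- `α_{k+1}`: the maximum of `α(G*)` over all unions `G*` of `k + 1` edge-disjoint `s`-`t` paths,
where dependency graphs are taken in the `k`-paths system. -/
def alphaSucc (s t : V) (k : ℕ) : ℝ :=
  sSup (alpha (G.kPathSystem s t k) '' G.pathUnions s t (k + 1))

end DirectedGraph

end Frugality

end

/-! The lower bound comes from cost vectors supported on one or two edges of a union `G*` of `k + 1`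
edge-disjoint paths, all edges outside `G*` having a prohibitively large cost `L`.

Deleting any one of the `k + 1` paths from `G*` leaves a feasible set. Adding up the corresponding
constraints `no_improvement` gives `μ(c) ≤ k · c(G*)` as soon as the cheapest set lies in `G*`
(`mu_le_mul_sum`). If all ratios are at most `r`, the total payment is thus at most
`r k · c(G*)` (`totalPayment_le`); for `L` large this forces the winners to lie in `G*`.

Let `e, e'` be adjacent in the dependency graph, let `e` cost `i` and `e'` cost `j`, and let the
rest of `G*` be free. One of `e, e'` wins. By truthfulness (`Mechanism.Truthful.le_payment`), if
`e'` wins then he is paid at least `j` when `e` costs `i` and everything else in `G*` is free.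
Counting the integer points `(i, j)` of the rectangle `[1, N e] × [1, N e']` according to the winner
and summing over all adjacent pairs yields `∑ N e * N e' ≤ r k ∑ N e * (N e + 1)`
(`sum_adj_mul_le`). Letting `N` be the rounding of a large multiple of a nonnegative vector `y`
gives `yᵀ A y ≤ r k yᵀ y` (`sum_adj_mul_le_sq`); taking for `y` the absolute value of an
eigenvector, every eigenvalue is at most `r k`. Counting on a grid plays the role of integrating
over the rectangle.

This treats the `μ`-frugality ratio. The frugality ratio is at least as large because `ν ≤ μ`. This
needs the programs to be feasible (`exists_isEquilibriumBid`): a bid vector of maximum total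
subject to `cost_le` and `no_improvement` exists by compactness, the absence of monopolies bounding
the bids, and by maximality it satisfies `tight`. -/

namespace Frugality

/-! ### Existence of equilibrium bids -/

section Benchmarks

lemma MonopolyFree.exists_notMem {E : Type*} {F : Set (Finset E)} (hF : MonopolyFree F) (e : E) :
    ∃ T ∈ F, e ∉ T := by
  by_contra! h
  have : e ∈ ⋂ S ∈ F, (S : Set E) := by simpa using h
  rw [hF] at this
  exact this

variable {E : Type*} [DecidableEq E] {F : Set (Finset E)}

theorem exists_isEquilibriumBid [Fintype E] (hF : MonopolyFree F) {c : E → ℝ≥0} {S : Finset E}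
    (hS : IsCheapest F c S) : ∃ b, IsEquilibriumBid F c S b := by
  classical
  let K : Set (E → ℝ≥0) := {b | b ∈ Set.Icc c (fun e => c e + ∑ e, c e) ∧
    ∀ T ∈ F, ∑ e ∈ S \ T, b e ≤ ∑ e ∈ T \ S, c e}
  have hK : IsCompact K := by
    have hcl : IsClosed (⋂ T ∈ F, {b : E → ℝ≥0 | ∑ e ∈ S \ T, b e ≤ ∑ e ∈ T \ S, c e}) :=
      isClosed_biInter fun T _ => isClosed_le (by fun_prop) continuous_const
    convert (isCompact_Icc (a := c) (b := fun e => c e + ∑ e, c e)).inter_right hcl using 1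
    ext b
    simp [K]
  have hcK : c ∈ K := by
    refine ⟨⟨le_rfl, fun e => le_self_add⟩, fun T hT => ?_⟩
    have h := hS.2 T hT
    rw [← Finset.sum_inter_add_sum_sdiff S T c, ← Finset.sum_inter_add_sum_sdiff T S c,
      Finset.inter_comm T S] at h
    exact le_of_add_le_add_left h
  obtain ⟨b, hb, hmax⟩ := hK.exists_isMaxOn ⟨c, hcK⟩
    (f := fun b : E → ℝ≥0 => ∑ e ∈ S, b e) (by fun_prop)
  refine ⟨b, hb.1.1, hb.2, fun e he => ?_⟩
  by_contra! hslack
  -- All constraints involving `b e` are strict, so `b e` can be raised by the least slack `δ`.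
  let U : Finset (Finset E) := Finset.univ.filter fun T => T ∈ F ∧ e ∉ T
  obtain ⟨T₀, hT₀, heT₀⟩ := hF.exists_notMem e
  have hU : U.Nonempty := ⟨T₀, by simp [U, hT₀, heT₀]⟩
  obtain ⟨T₁, hT₁, hmin⟩ := U.exists_min_image
    (fun T => ∑ e' ∈ T \ S, c e' - ∑ e' ∈ S \ T, b e') hU
  set δ : ℝ≥0 := ∑ e' ∈ T₁ \ S, c e' - ∑ e' ∈ S \ T₁, b e' with hδ
  have hδ0 : 0 < δ := by
    simp only [U, Finset.mem_filter, Finset.mem_univ, true_and] at hT₁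
    exact tsub_pos_of_lt (lt_of_le_of_ne (hb.2 T₁ hT₁.1) (hslack T₁ hT₁.1 hT₁.2))
  have hsum : ∀ A : Finset E, e ∈ A →
      ∑ e' ∈ A, Function.update b e (b e + δ) e' = ∑ e' ∈ A, b e' + δ := by
    intro A hA
    rw [Finset.sum_update_of_mem hA, ← Finset.add_sum_erase A b hA, Finset.sdiff_singleton_eq_erase]
    ring
  have hfeas : ∀ T ∈ F, ∑ e' ∈ S \ T, Function.update b e (b e + δ) e' ≤ ∑ e' ∈ T \ S, c e' := by
    intro T hT
    by_cases heT : e ∈ T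
    · rw [Finset.sum_update_of_notMem (by simp [heT])]
      exact hb.2 T hT
    · rw [hsum _ (by simp [he, heT])]
      have h := hmin T (by simp [U, hT, heT])
      calc _ ≤ ∑ e' ∈ S \ T, b e' + (∑ e' ∈ T \ S, c e' - ∑ e' ∈ S \ T, b e') := by gcongr
        _ = _ := add_tsub_cancel_of_le (hb.2 T hT)
  have hK' : Function.update b e (b e + δ) ∈ K := by
    refine ⟨⟨fun e' => ?_, fun e' => ?_⟩, hfeas⟩
    · rcases eq_or_ne e' e with rfl | hne
      · simpa using (hb.1.1 e').trans le_self_add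
      · simpa [hne] using hb.1.1 e'
    · rcases eq_or_ne e' e with rfl | hne
      · calc _ ≤ ∑ e'' ∈ S \ T₀, Function.update b e' (b e' + δ) e'' :=
              Finset.single_le_sum_of_canonicallyOrdered (by simp [he, heT₀])
          _ ≤ ∑ e'' ∈ T₀ \ S, c e'' := hfeas T₀ hT₀
          _ ≤ ∑ e'', c e'' := Finset.sum_le_univ_sum_of_nonneg fun _ => zero_le
          _ ≤ _ := le_add_self
      · simpa [hne] using hb.1.2 e'
  have h := hmax hK'
  simp only [Set.mem_ofPred_eq, hsum S he] at h
  exact absurd h (not_le.2 (lt_add_of_pos_right _ hδ0))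

theorem nu_le_mu [Fintype E] (hF : MonopolyFree F) {c : E → ℝ≥0} {S : Finset E}
    (hS : IsCheapest F c S) : nu F c S ≤ mu F c S := by
  obtain ⟨b, hb⟩ := exists_isEquilibriumBid hF hS
  exact (iInf₂_le b hb).trans
    (le_iSup₂ (f := fun b (_ : IsEquilibriumBid F c S b) => ((∑ e ∈ S, b e : ℝ≥0) : ℝ≥0∞)) b hb)

/-! ### An upper bound on `μ` -/

/-- If `Gs` is the disjoint union of `k + 1` parts such that every `k` of them form a feasible set,
then `μ(c) ≤ k · c(Gs)`: each edge of `Gs` is in `k` of the `k + 1` sets `Gs \ Q j`. -/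
theorem mu_le_mul_sum {k : ℕ} {Q : Fin (k + 1) → Finset E}
    (hQ : Pairwise fun i j => Disjoint (Q i) (Q j))
    (hQF : ∀ j, Finset.univ.biUnion Q \ Q j ∈ F) (c : E → ℝ≥0) {S : Finset E}
    (hS : S ⊆ Finset.univ.biUnion Q) :
    mu F c S ≤ ((k * ∑ e ∈ Finset.univ.biUnion Q, c e : ℝ≥0) : ℝ≥0∞) := by
  refine iSup₂_le fun b hb => ENNReal.coe_le_coe.2 ?_
  set Gs := Finset.univ.biUnion Q with hGs
  have hQs : ∀ j, Q j ⊆ Gs := fun j => Finset.subset_biUnion_of_mem Q (Finset.mem_univ j)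
  have hSu : S = Finset.univ.biUnion fun j => S \ (Gs \ Q j) := by
    ext e
    simp only [Finset.mem_biUnion, Finset.mem_univ, true_and, Finset.mem_sdiff]
    constructor
    · intro he
      obtain ⟨j, -, hj⟩ := Finset.mem_biUnion.1 (hS he)
      exact ⟨j, he, fun h => h.2 hj⟩
    · rintro ⟨j, he, -⟩
      exact he
  have h1 : ∑ e ∈ S, b e ≤ ∑ j, ∑ e ∈ Gs \ Q j, c e := by
    calc ∑ e ∈ S, b e = ∑ j, ∑ e ∈ S \ (Gs \ Q j), b e := by
          conv_lhs => rw [hSu]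
          refine Finset.sum_biUnion fun i _ j _ hij => ?_
          refine Finset.disjoint_left.2 fun e hi hj => ?_
          simp only [Finset.mem_sdiff, not_and, not_not] at hi hj
          exact Finset.disjoint_left.1 (hQ hij) (hi.2 (hS hi.1)) (hj.2 (hS hj.1))
      _ ≤ _ := Finset.sum_le_sum fun j _ => (hb.no_improvement _ (hQF j)).trans
          (Finset.sum_le_sum_of_subset Finset.sdiff_subset)
  have h2 : ∑ j, ∑ e ∈ Gs \ Q j, c e + ∑ e ∈ Gs, c e = k * ∑ e ∈ Gs, c e + ∑ e ∈ Gs, c e := by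
    conv_lhs => rw [hGs, Finset.sum_biUnion fun i _ j _ hij => hQ hij, ← hGs]
    rw [← Finset.sum_add_distrib,
      Finset.sum_congr rfl fun j _ => Finset.sum_sdiff (f := c) (hQs j)]
    simp
    ring
  exact h1.trans (add_right_cancel h2).le

/-! ### Payments -/

/-- A bid with which an agent would win is a lower bound for his payment at any lower bid. -/
theorem Mechanism.Truthful.le_payment {M : Mechanism F} (hM : M.Truthful) {b : E → ℝ≥0} {e : E}
    {y : ℝ≥0} (hy : b e ≤ y) (hwin : e ∈ M.winners (Function.update b e y)) :
    y ≤ M.payment b e := by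
  have hp := M.bid_le_payment _ e hwin
  rw [Function.update_self] at hp
  rcases hy.eq_or_lt with rfl | hlt
  · rwa [Function.update_eq_self] at hp
  have hu := hM e b y hy
  have hp' : (y : ℝ) ≤ M.payment (Function.update b e y) e := by exact_mod_cast hp
  have hlt' : (b e : ℝ) < y := by exact_mod_cast hlt
  simp only [Mechanism.utility, if_pos hwin] at hu
  split_ifs at hu with h
  · have : (y : ℝ) ≤ M.payment b e := by linarith
    exact_mod_cast this
  · linarith

theorem Mechanism.muFrugalityRatio_le_frugalityRatio [Fintype E] (hF : MonopolyFree F)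
    (M : Mechanism F) {S : (E → ℝ≥0) → Finset E} (hS : ∀ c, IsCheapest F c (S c)) :
    M.muFrugalityRatio S ≤ M.frugalityRatio S :=
  iSup_mono fun c => ENNReal.div_le_div_left (nu_le_mu hF (hS c)) _

/-- If every edge outside `Gs` costs more than all of `Gs`, then the total payment is at most
`r k · c(Gs)`, where `r` is the `μ`-frugality ratio. -/
theorem totalPayment_le [Fintype E] {k : ℕ} {Q : Fin (k + 1) → Finset E}
    (hQ : Pairwise fun i j => Disjoint (Q i) (Q j))
    (hQF : ∀ j, Finset.univ.biUnion Q \ Q j ∈ F) {S : (E → ℝ≥0) → Finset E}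
    (hS : ∀ c, IsCheapest F c (S c)) {M : Mechanism F} {r : ℝ≥0} (hr : M.muFrugalityRatio S ≤ r)
    {c : E → ℝ≥0} (hc : ∀ e ∉ Finset.univ.biUnion Q, ∑ e' ∈ Finset.univ.biUnion Q, c e' < c e) :
    M.totalPayment c ≤ r * k * ∑ e ∈ Finset.univ.biUnion Q, c e := by
  have hSs : S c ⊆ Finset.univ.biUnion Q := by
    intro e he
    by_contra hne
    have h1 : c e ≤ ∑ e' ∈ S c, c e' := Finset.single_le_sum_of_canonicallyOrdered he
    have h2 := (hS c).2 _ (hQF 0)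
    have h3 : ∑ e' ∈ Finset.univ.biUnion Q \ Q 0, c e' ≤ ∑ e' ∈ Finset.univ.biUnion Q, c e' :=
      Finset.sum_le_sum_of_subset Finset.sdiff_subset
    exact absurd (hc e hne) (not_lt.2 (h1.trans (h2.trans h3)))
  have hmu := mu_le_mul_sum hQ hQF c hSs
  have hdiv : (M.totalPayment c : ℝ≥0∞) / mu F c (S c) ≤ r :=
    (le_iSup (fun c => (M.totalPayment c : ℝ≥0∞) / mu F c (S c)) c).trans hr
  have hne : mu F c (S c) ≠ ⊤ := ne_top_of_le_ne_top ENNReal.coe_ne_top hmu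
  have h := (ENNReal.div_le_iff_le_mul (Or.inr ENNReal.coe_ne_top) (Or.inl hne)).1 hdiv
  have h' : (M.totalPayment c : ℝ≥0∞) ≤ r * ((k * ∑ e ∈ Finset.univ.biUnion Q, c e : ℝ≥0) : ℝ≥0∞) :=
    h.trans (by gcongr)
  rw [mul_assoc]
  exact_mod_cast h'

/-! ### Counting winners on a grid -/

open Classical in
/-- For adjacent `u, v` one of the two wins at each of the `N u * N v` integer points of their
rectangle, while the points `(i, j)` with fixed `i` at which `v` wins are at most as many as the
payment to `v` when only `u` has a cost, namely `i`. -/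
theorem sum_adj_mul_le [Fintype E] {k : ℕ} {Q : Fin (k + 1) → Finset E} {Gs : Finset E}
    (hGs : Gs = Finset.univ.biUnion Q)
    (hQ : Pairwise fun i j => Disjoint (Q i) (Q j))
    (hQF : ∀ j, Gs \ Q j ∈ F) {S : (E → ℝ≥0) → Finset E}
    (hS : ∀ c, IsCheapest F c (S c)) {M : Mechanism F} (hM : M.Truthful) {r : ℝ≥0}
    (hr : M.muFrugalityRatio S ≤ r) (N : Gs → ℕ) :
    ∑ u, ∑ v, (if (dependencyGraph F Gs).Adj u v
      then (N u * N v : ℝ) else 0) ≤ r * k * ∑ u, (N u * (N u + 1) : ℝ) := by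
  have hpay : ∀ c : E → ℝ≥0, (∀ e ∉ Gs, ∑ e' ∈ Gs, c e' < c e) →
      M.totalPayment c ≤ r * k * ∑ e ∈ Gs, c e := by
    subst hGs
    exact fun c => totalPayment_le hQ hQF hS hr
  set H := dependencyGraph F Gs
  let K : ℝ≥0 := ∑ u, (N u : ℝ≥0)
  have hNK : ∀ u, (N u : ℝ≥0) ≤ K := fun u =>
    Finset.single_le_sum_of_canonicallyOrdered (f := fun u => (N u : ℝ≥0)) (Finset.mem_univ u)
  -- `L` exceeds both the largest possible cost `2 K` of `Gs` and the payment bound there.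
  let L : ℝ≥0 := (r * k + 1) * (2 * K) + 1
  have hL1 : 2 * K < L := by
    have : L = 2 * K + (r * k * (2 * K) + 1) := by simp only [L]; ring
    rw [this]
    exact lt_add_of_pos_right _ (by positivity)
  have hL2 : r * k * (2 * K) < L := by
    have : L = r * k * (2 * K) + (2 * K + 1) := by simp only [L]; ring
    rw [this]
    exact lt_add_of_pos_right _ (by positivity)
  let base : E → ℝ≥0 := fun e => if e ∈ Gs then 0 else L
  let solo : Gs → ℕ → E → ℝ≥0 := fun u i => Function.update base u i
  let pair : Gs → Gs → ℕ → ℕ → E → ℝ≥0 := fun u v i j => Function.update (solo u i) v j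
  have hsolo : ∀ u i, ∑ e ∈ Gs, solo u i e = i := fun u i => by
    rw [Finset.sum_update_of_mem u.2, Finset.sum_eq_zero, add_zero]
    intro e he
    simp [base, (Finset.mem_sdiff.1 he).1]
  have hpair : ∀ u v, ∀ i j : ℕ, ∑ e ∈ Gs, pair u v i j e ≤ i + j := fun u v i j => by
    rw [Finset.sum_update_of_mem v.2, add_comm, ← hsolo u i]
    gcongr
    exact Finset.sdiff_subset
  have hsolo_out : ∀ u i, ∀ e ∉ Gs, solo u i e = L := fun u i e he => by
    have : e ≠ u := fun h => he (h ▸ u.2)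
    simp [solo, base, this, he]
  have hpair_out : ∀ u v i j, ∀ e ∉ Gs, pair u v i j e = L := fun u v i j e he => by
    have : e ≠ v := fun h => he (h ▸ v.2)
    simp only [pair, Function.update_of_ne this]
    exact hsolo_out u i e he
  have hsolo_pay : ∀ u i, i ≤ N u → M.totalPayment (solo u i) ≤ r * k * i := by
    intro u i hi
    have hiK : (i : ℝ≥0) ≤ 2 * K :=
      calc (i : ℝ≥0) ≤ N u := by exact_mod_cast hi
        _ ≤ K := hNK u
        _ ≤ 2 * K := by rw [two_mul]; exact le_self_add
    have h := hpay (solo u i) fun e he => by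
      rw [hsolo, hsolo_out u i e he]
      exact hiK.trans_lt hL1
    rwa [hsolo] at h
  have hwin : ∀ u v i j, i ≤ N u → j ≤ N v → H.Adj u v →
      (u : E) ∈ M.winners (pair u v i j) ∨ (v : E) ∈ M.winners (pair u v i j) := by
    intro u v i j hi hj hadj
    have hijK : (i : ℝ≥0) + j ≤ 2 * K := by
      rw [two_mul]
      exact add_le_add ((Nat.cast_le.2 hi).trans (hNK u)) ((Nat.cast_le.2 hj).trans (hNK v))
    refine hadj.2 _ (M.winners_mem _) fun e he => ?_
    by_contra hne
    have h1 : pair u v i j e ≤ M.totalPayment (pair u v i j) :=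
      (M.bid_le_payment _ e he).trans
        (Finset.single_le_sum_of_canonicallyOrdered (Finset.mem_univ e))
    have h2 := hpay (pair u v i j) fun e he => by
      rw [hpair_out u v i j e he]
      exact ((hpair u v i j).trans hijK).trans_lt hL1
    have h3 : r * k * ∑ e ∈ Gs, pair u v i j e ≤ r * k * (2 * K) := by
      gcongr
      exact (hpair u v i j).trans hijK
    rw [hpair_out u v i j e hne] at h1
    exact absurd hL2 (not_lt.2 (h1.trans (h2.trans h3)))
  -- `A u v` counts the grid points at which `v` wins.
  let A : Gs → Gs → ℝ := fun u v => ∑ i ∈ Finset.Icc 1 (N u), ∑ j ∈ Finset.Icc 1 (N v),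
    if (v : E) ∈ M.winners (pair u v i j) then (1 : ℝ) else 0
  have hA : ∀ u v, H.Adj u v → (N u * N v : ℝ) ≤ A u v + A v u := by
    intro u v hadj
    have hswap : A v u = ∑ i ∈ Finset.Icc 1 (N u), ∑ j ∈ Finset.Icc 1 (N v),
        if (u : E) ∈ M.winners (pair u v i j) then (1 : ℝ) else 0 := by
      simp only [A]
      rw [Finset.sum_comm]
      refine Finset.sum_congr rfl fun i _ => Finset.sum_congr rfl fun j _ => ?_
      have hne : (u : E) ≠ v := fun h => hadj.1 (Subtype.ext h)
      simp only [pair, solo, Function.update_comm hne]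
    rw [hswap, ← Finset.sum_add_distrib]
    calc (N u * N v : ℝ)
        = ∑ i ∈ Finset.Icc 1 (N u), ∑ j ∈ Finset.Icc 1 (N v), (1 : ℝ) := by simp
      _ ≤ _ := Finset.sum_le_sum fun i hi => by
          rw [← Finset.sum_add_distrib]
          refine Finset.sum_le_sum fun j hj => ?_
          rcases hwin u v i j (Finset.mem_Icc.1 hi).2 (Finset.mem_Icc.1 hj).2 hadj with h | h
          · rw [if_pos h]
            split_ifs <;> norm_num
          · rw [if_pos h]
            split_ifs <;> norm_num
  have hcount : ∀ u v i, H.Adj u v → (∑ j ∈ Finset.Icc 1 (N v),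
      if (v : E) ∈ M.winners (pair u v i j) then (1 : ℝ) else 0) ≤ M.payment (solo u i) v := by
    intro u v i hadj
    rw [Finset.sum_boole]
    have hsub : (Finset.Icc 1 (N v)).filter (fun j => (v : E) ∈ M.winners (pair u v i j)) ⊆
        Finset.Icc 1 ⌊M.payment (solo u i) v⌋₊ := by
      intro j hj
      rw [Finset.mem_filter, Finset.mem_Icc] at hj
      refine Finset.mem_Icc.2 ⟨hj.1.1, Nat.le_floor (hM.le_payment ?_ hj.2)⟩
      have hne : (v : E) ≠ u := fun h => hadj.1 (Subtype.ext h.symm)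
      simp [solo, base, hne]
    have hcard := Finset.card_le_card hsub
    rw [Nat.card_Icc, Nat.add_sub_cancel] at hcard
    have hle : ((Finset.filter (fun j => (v : E) ∈ M.winners (pair u v i j))
        (Finset.Icc 1 (N v))).card : ℝ≥0) ≤ M.payment (solo u i) v :=
      (Nat.cast_le.2 hcard).trans (Nat.floor_le (zero_le))
    exact_mod_cast hle
  have hrow : ∀ u, ∑ v, (if H.Adj u v then A u v else 0) ≤ r * k * (N u * (N u + 1) / 2) := by
    intro u
    calc ∑ v, (if H.Adj u v then A u v else 0)
        ≤ ∑ v : Gs, ∑ i ∈ Finset.Icc 1 (N u), (M.payment (solo u i) v : ℝ) := by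
          refine Finset.sum_le_sum fun v _ => ?_
          split_ifs with h
          · exact Finset.sum_le_sum fun i _ => hcount u v i h
          · exact Finset.sum_nonneg fun i _ => NNReal.coe_nonneg _
      _ = ∑ i ∈ Finset.Icc 1 (N u), ∑ v : Gs, (M.payment (solo u i) v : ℝ) := Finset.sum_comm
      _ ≤ ∑ i ∈ Finset.Icc 1 (N u), (r * k * i : ℝ) := by
          refine Finset.sum_le_sum fun i hi => ?_
          have h1 : ∑ v : Gs, M.payment (solo u i) v ≤ M.totalPayment (solo u i) := by
            rw [Finset.sum_coe_sort Gs (fun v => M.payment (solo u i) v)]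
            exact Finset.sum_le_sum_of_subset (Finset.subset_univ _)
          exact_mod_cast h1.trans (hsolo_pay u i (Finset.mem_Icc.1 hi).2)
      _ = r * k * (N u * (N u + 1) / 2) := by
          rw [← Finset.mul_sum]
          congr 1
          generalize N u = n
          induction n with
          | zero => simp
          | succ n ih =>
            rw [Finset.sum_Icc_succ_top (by omega), ih]
            push_cast
            ring
  have hsymm : ∑ u, ∑ v, (if H.Adj u v then A v u else 0) =
      ∑ u, ∑ v, (if H.Adj u v then A u v else 0) := by
    rw [Finset.sum_comm]
    simp only [H.adj_comm]
  have hle : ∑ u, ∑ v, (if H.Adj u v then (N u * N v : ℝ) else 0) ≤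
      ∑ u, ∑ v, (if H.Adj u v then A u v else 0) + ∑ u, ∑ v, (if H.Adj u v then A v u else 0) := by
    simp only [← Finset.sum_add_distrib]
    refine Finset.sum_le_sum fun u _ => Finset.sum_le_sum fun v _ => ?_
    split_ifs with h
    · exact hA u v h
    · simp
  have htot := Finset.sum_le_sum fun u (_ : u ∈ Finset.univ) => hrow u
  rw [hsymm] at hle
  rw [← Finset.mul_sum, ← Finset.sum_div] at htot
  linarith

end Benchmarks

/-! ### From the grid to the spectrum -/

open Classical Filter Topology in
/-- An inequality of degree two on integer vectors, up to lower order terms, holds exactly for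
nonnegative real vectors. -/
theorem sum_adj_mul_le_sq {V : Type*} [Fintype V] (H : SimpleGraph V) {B : ℝ}
    (h : ∀ N : V → ℕ, ∑ u, ∑ v, (if H.Adj u v then (N u * N v : ℝ) else 0) ≤
      B * ∑ u, (N u * (N u + 1) : ℝ)) {y : V → ℝ} (hy : ∀ v, 0 ≤ y v) :
    ∑ u, ∑ v, (if H.Adj u v then y u * y v else 0) ≤ B * ∑ u, y u * y u := by
  have hlim : ∀ v, Tendsto (fun n : ℕ => (⌊y v * n⌋₊ : ℝ) / n) atTop (𝓝 (y v)) := fun v =>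
    (tendsto_nat_floor_mul_div_atTop (hy v)).comp tendsto_natCast_atTop_atTop
  have hinv : Tendsto (fun n : ℕ => (1 : ℝ) / n) atTop (𝓝 0) := tendsto_one_div_atTop_nhds_zero_nat
  have hleft : Tendsto (fun n : ℕ => ∑ u, ∑ v,
      (if H.Adj u v then ((⌊y u * n⌋₊ : ℝ) / n) * ((⌊y v * n⌋₊ : ℝ) / n) else 0)) atTop
      (𝓝 (∑ u, ∑ v, (if H.Adj u v then y u * y v else 0))) := by
    refine tendsto_finsetSum _ fun u _ => tendsto_finsetSum _ fun v _ => ?_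
    split_ifs
    · exact (hlim u).mul (hlim v)
    · exact tendsto_const_nhds
  have hright : Tendsto (fun n : ℕ => B * ∑ u,
      ((⌊y u * n⌋₊ : ℝ) / n) * ((⌊y u * n⌋₊ : ℝ) / n + 1 / n)) atTop
      (𝓝 (B * ∑ u, y u * (y u + 0))) :=
    (tendsto_finsetSum _ fun u _ => (hlim u).mul ((hlim u).add hinv)).const_mul B
  simp only [add_zero] at hright
  refine le_of_tendsto_of_tendsto hleft hright ?_
  filter_upwards [eventually_gt_atTop 0] with n hn
  have hn' : (0 : ℝ) < n := Nat.cast_pos.2 hn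
  have key := div_le_div_of_nonneg_right (h fun v => ⌊y v * n⌋₊) (mul_pos hn' hn').le
  calc _ = (∑ u, ∑ v, (if H.Adj u v then (⌊y u * n⌋₊ * ⌊y v * n⌋₊ : ℝ) else 0)) / (n * n) := by
        simp only [Finset.sum_div]
        refine Finset.sum_congr rfl fun u _ => Finset.sum_congr rfl fun v _ => ?_
        split_ifs
        · rw [div_mul_div_comm]
        · simp
    _ ≤ _ := key
    _ = _ := by
        rw [mul_div_assoc, Finset.sum_div]
        congr 1
        refine Finset.sum_congr rfl fun u _ => ?_
        rw [← add_div, div_mul_div_comm]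

open Classical in
/-- An upper bound for the quadratic form of a graph on nonnegative vectors bounds the eigenvalues
of its induced subgraphs: replace an eigenvector by its absolute value, extended by zero. -/
theorem le_of_hasEigenvalue_induce {V : Type*} [Fintype V] (H : SimpleGraph V) {B : ℝ}
    (h : ∀ y : V → ℝ, (∀ v, 0 ≤ y v) →
      ∑ u, ∑ v, (if H.Adj u v then y u * y v else 0) ≤ B * ∑ u, y u * y u)
    (C : Set V) [Fintype C] {a : ℝ}
    (ha : Module.End.HasEigenvalue (Matrix.toLin' ((H.induce C).adjMatrix ℝ)) a) : a ≤ B := by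
  obtain ⟨x, hx⟩ := ha.exists_hasEigenvector
  have hxe : ∀ u : C, ∑ v : C, (if H.Adj u v then x v else 0) = a * x u := fun u => by
    have := congrFun hx.apply_eq_smul u
    simpa [Matrix.mulVec, dotProduct, SimpleGraph.adjMatrix_apply] using this
  let y : V → ℝ := Function.extend Subtype.val (fun u : C => |x u|) 0
  have hyC : ∀ u : C, y u = |x u| := fun u => Subtype.val_injective.extend_apply _ _ u
  have hy0 : ∀ u ∉ Set.range (Subtype.val : C → V), y u = 0 := fun u hu =>
    Function.extend_apply' _ _ _ hu
  have hy : ∀ u, 0 ≤ y u := by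
    intro u
    by_cases hu : u ∈ Set.range (Subtype.val : C → V)
    · obtain ⟨u, rfl⟩ := hu
      rw [hyC]
      exact abs_nonneg _
    · exact (hy0 u hu).ge
  have hB := h y hy
  have h1 : ∑ u : C, x u * x u = ∑ u, y u * y u :=
    Fintype.sum_of_injective _ Subtype.val_injective _ _ (fun u hu => by simp [hy0 u hu])
      fun u => by rw [hyC, abs_mul_abs_self]
  have h2 : ∑ u : C, ∑ v : C, (if H.Adj u v then |x u| * |x v| else 0) =
      ∑ u, ∑ v, (if H.Adj u v then y u * y v else 0) :=
    Fintype.sum_of_injective _ Subtype.val_injective _ _ (fun u hu => by simp [hy0 u hu])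
      fun u => Fintype.sum_of_injective _ Subtype.val_injective _ _
        (fun v hv => by simp [hy0 v hv]) fun v => by rw [hyC, hyC]
  have h3 : a * ∑ u : C, x u * x u ≤
      ∑ u : C, ∑ v : C, (if H.Adj u v then |x u| * |x v| else 0) := by
    rw [Finset.mul_sum]
    refine Finset.sum_le_sum fun u _ => ?_
    rw [← mul_assoc, ← hxe, Finset.sum_mul]
    refine Finset.sum_le_sum fun v _ => ?_
    split_ifs
    · rw [← abs_mul, mul_comm]
      exact le_abs_self _
    · simp
  have hpos : 0 < ∑ u : C, x u * x u := by
    obtain ⟨u, hu⟩ := Function.ne_iff.1 hx.2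
    exact Finset.sum_pos' (fun v _ => mul_self_nonneg _)
      ⟨u, Finset.mem_univ u, mul_self_pos.2 hu⟩
  rw [h2] at h3
  rw [← h1] at hB
  exact le_of_mul_le_mul_right (h3.trans hB) hpos

theorem alpha_le {E : Type*} {F : Set (Finset E)} {Gs : Finset E} {B : ℝ} (hB : 0 ≤ B)
    (h : ∀ C : Set Gs, ∀ a, [Fintype C] → [DecidableEq C] →
      [DecidableRel ((dependencyGraph F Gs).induce C).Adj] →
      Module.End.HasEigenvalue
        (Matrix.toLin' (((dependencyGraph F Gs).induce C).adjMatrix ℝ)) a → a ≤ B) :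
    alpha F Gs ≤ B := by
  classical
  exact Real.iSup_le (fun C => Real.sSup_le (fun a ha => @h C.supp a _ _ _ ha) hB) hB

/-! ### Unions of disjoint paths -/

/-- A union of `k + 1` edge-disjoint paths is a disjoint union of `k + 1` sets, the deletion of any
of which leaves a feasible set of the `k`-paths system. -/
theorem DirectedGraph.exists_parts_of_mem_pathUnions {V E : Type*} [DecidableEq E]
    (G : DirectedGraph V E) {s t : V} {k : ℕ} {Gs : Finset E}
    (hGs : Gs ∈ G.pathUnions s t (k + 1)) :
    ∃ Q : Fin (k + 1) → Finset E, Gs = Finset.univ.biUnion Q ∧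
      (Pairwise fun i j => Disjoint (Q i) (Q j)) ∧
      ∀ j, Finset.univ.biUnion Q \ Q j ∈ G.kPathSystem s t k := by
  obtain ⟨P, ⟨hP, hdisj⟩, hmem⟩ := hGs
  refine ⟨fun i => (P i).toFinset, by ext e; simp [hmem], fun i j hij => ?_, fun j => ?_⟩
  · exact List.disjoint_toFinset_iff_disjoint.2 (hdisj i j hij)
  · refine ⟨fun i => P (j.succAbove i), ⟨fun i => hP _, fun i i' hii' => hdisj _ _ fun h =>
      hii' (Fin.succAbove_right_injective h)⟩, fun i e he => ?_⟩
    simp only [Finset.mem_sdiff, Finset.mem_biUnion, Finset.mem_univ, true_and, List.mem_toFinset]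
    exact ⟨⟨_, he⟩, fun hj => hdisj _ _ (Fin.succAbove_ne j i) he hj⟩

end Frugality

open Frugality in
theorem mainTheorem1 {V E : Type*} [Fintype E] [DecidableEq E]
    (G : Frugality.DirectedGraph V E) (s t : V) (k : ℕ) (hk : 1 ≤ k)
    (hG : Frugality.MonopolyFree (G.kPathSystem s t k))
    (S : (E → ℝ≥0) → Finset E)
    (hS : ∀ c, Frugality.IsCheapest (G.kPathSystem s t k) c (S c))
    (M : Frugality.Mechanism (G.kPathSystem s t k))
    (hM : M.Truthful) (hmeas : M.LebesgueMeasurable) :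
    ENNReal.ofReal (G.alphaSucc s t k / k) ≤ M.frugalityRatio S ∧
      ENNReal.ofReal (G.alphaSucc s t k / k) ≤ M.muFrugalityRatio S := by
  suffices h : ENNReal.ofReal (G.alphaSucc s t k / k) ≤ M.muFrugalityRatio S from
    ⟨h.trans (M.muFrugalityRatio_le_frugalityRatio hG hS), h⟩
  rcases eq_or_ne (M.muFrugalityRatio S) ⊤ with htop | htop
  · simp [htop]
  lift M.muFrugalityRatio S to ℝ≥0 using htop with r hr
  rw [← ENNReal.ofReal_coe_nnreal]
  refine ENNReal.ofReal_le_ofReal ((div_le_iff₀ (by exact_mod_cast hk)).2 ?_)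
  have hB : (0 : ℝ) ≤ r * k := by positivity
  refine Real.sSup_le ?_ hB
  rintro _ ⟨Gs, hGs, rfl⟩
  obtain ⟨Q, rfl, hQ, hQF⟩ := G.exists_parts_of_mem_pathUnions hGs
  refine alpha_le hB fun C a _ _ _ ha => ?_
  refine le_of_hasEigenvalue_induce _ (fun y hy => sum_adj_mul_le_sq _
    (fun N => sum_adj_mul_le rfl hQ hQF hS hM hr.ge N) hy) C ?_
  convert ha
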